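/- Let $GL_2$ denote the group of real $2\times 2$ matrices with positive determinant and $SL_2$ the subgroup of matrices with determinant $1$. Let $\Omega\subset\mathbb R^2$ be a nonempty, bounded, open set with smooth boundary. A diffeomorphism of $\Omega$ with compact support is a $C^\infty$ diffeomorphism $\phi$ of $\mathbb R^2$ such that the support of $\phi-\mathrm{id}$ is a compact subset of $\Omega$; its gradient then takes values in $GL_2$, and $\phi$ is volume preserving if $\nabla\phi(x)\in SL_2$ for all $x$. (1) Let $W\in C^2(SL_2,\mathbb R)$, and suppose that the integral $$\int_\Omega W(\nabla\phi)\,dx$$ has the same value for all volume preserving diffeomorphisms $\phi$ of $\Omega$ with compact support. Then there are constants $a_{ij},b\in\mathbb R$ $(1\le i,j\le 2)$ such that $$W(F)=\sum_{i,j=1}^2 a_{ij}F_{ij}+b\qquad\text{for all }F\in SL_2 .$$ (2) Let $W\in C^2(GL_2,\mathbb R)$, and suppose that $$\int_\Omega W(\nabla(u\circ\phi))\,dx=\int_\Omega W(\nabla u)\,dx$$ for every diffeomorphism $u$ of $\Omega$ with compact support and every volume preserving diffeomorphism $\phi$ of $\Omega$ with compact support. Then there are functions $a_{ij},b:(0,\infty)\to\mathbb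 R$ $(1\le i,j\le 2)$ such that $$W(F)=\sum_{i,j=1}^2 a_{ij}(\det F)\,F_{ij}+b(\det F)\qquad\text{for all }F\in GL_2 .$$ -/

import Mathlib

open scoped ContDiff

-- The entrywise maximum norm on matrices. All norms on this finite-dimensional space are
-- equivalent; the norm is only used to speak of `C²` functions of a matrix.
attribute [local instance] Matrix.normedAddCommGroup Matrix.normedSpace

/-- The Euclidean plane. -/
abbrev Plane : Type := EuclideanSpace ℝ (Fin 2)

/-- Real `2 × 2` matrices. -/
abbrev Mat2 : Type := Matrix (Fin 2) (Fin 2) ℝ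

/-- `SL₂`, as a subset of the space of matrices. -/
def SL2 : Set Mat2 := {F | F.det = 1}

/-- The orientation preserving general linear group `GL₂`, i.e. the matrices of positive
determinant. -/
def GL2 : Set Mat2 := {F | 0 < F.det}

/-- The gradient of a map of the plane, with entries `(∇φ)ᵢⱼ = ∂φᵢ/∂xⱼ`. -/
noncomputable def grad (φ : Plane → Plane) (x : Plane) : Mat2 :=
  Matrix.of fun i j => (fderiv ℝ φ x (EuclideanSpace.single j 1)) i

/-- `[M](Ω)`: the smooth diffeomorphisms of the plane with gradient everywhere in `M` which
differ from the identity only inside a compact subset of `Ω`. They are the diffeomorphisms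
`Ω → Ω` with compact support in `Ω`, extended by the identity. For `M = GL2` these are all
such diffeomorphisms, for `M = SL2` the volume preserving ones. -/
structure IsCompactDiffeo (M : Set Mat2) (Ω : Set Plane) (φ : Plane → Plane) : Prop where
  smooth : ContDiff ℝ ∞ φ
  smooth_inverse : ∃ ψ : Plane → Plane,
    ContDiff ℝ ∞ ψ ∧ Function.LeftInverse ψ φ ∧ Function.RightInverse ψ φ
  grad_mem : ∀ x, grad φ x ∈ M
  hasCompactSupport : HasCompactSupport fun x => φ x - x
  support_subset : tsupport (fun x => φ x - x) ⊆ Ω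

/-- An open set has smooth boundary if near each boundary point it is the sublevel set
`{ρ < 0}` of a smooth function `ρ` whose differential does not vanish at that point. -/
def HasSmoothBoundary (Ω : Set Plane) : Prop :=
  ∀ x ∈ frontier Ω, ∃ U : Set Plane, IsOpen U ∧ x ∈ U ∧ ∃ ρ : Plane → ℝ,
    ContDiffOn ℝ ∞ ρ U ∧ fderiv ℝ ρ x ≠ 0 ∧ Ω ∩ U = {y | y ∈ U ∧ ρ y < 0}

/-!
The invariance of the integral is tested on explicit diffeomorphisms whose gradients concentrate
near simple shears. This makes `W` affine along all shear lines of `SL₂`, and hence affine.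

*The diffeomorphisms.* Rotating each circle about the origin by an angle depending smoothly on its
radius gives a compactly supported area preserving map, the `twist`. Conjugating twists by affine
maps, and composing, produces for every `F ∈ SL₂` a compactly supported area preserving
diffeomorphism of `Ω` with constant gradient `F` near a given point (`localGradients_SL2`), because
conjugates of rotations generate `SL₂`. Composing further with small Lipschitz perturbations of the
identity gives the same for `F ∈ GL₂` in the class of all diffeomorphisms
(`smul_mem_localGradients_GL2`).

*Localisation.* Let `u` have gradient `F` near a point. Shrinking a diffeomorphism `φ` into the
region where `u` is affine turns both hypotheses into `∫ (W (F A ∇φ A⁻¹) - W F) = 0` for every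
compactly supported area preserving `φ` of the plane and every invertible `A`
(`integral_conj_eq_zero`).

*Concentration.* Take for `φ` the twist by an angle proportional to `ε`, and `A = diag (1, ε)`. As
`ε → 0` the gradients `A ∇φ A⁻¹` converge uniformly to a pure shear `U (t m(x))` with a nonzero
profile `m`, where `U s = !![1, s; 0, 1]`. Hence `∫ (W (P U(t m(x)) Q) - W (P Q)) dx = 0` for all
`P, Q ∈ SL₂` (`integral_upperShear_eq_zero`). So the increments of `t ↦ W (P U(t) Q)` average to
zero along `m`, and by a maximum principle this function is affine
(`exists_affine_of_integral_eq_zero`).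

*Algebra.* A function on `SL₂` which is affine along all these lines is the restriction of an
affine function of the matrix entries (`exists_affine_of_affine_upperShear`). For `GL₂`, the
argument applies to `F ↦ W (r F)` on `SL₂` for each `r > 0`, which treats the matrices of
determinant `r²`.
-/

open Filter Topology MeasureTheory Set

/-! ### Matrices acting on the plane, and the gradient -/

/-- A matrix, as a continuous linear endomorphism of the Euclidean plane. -/
noncomputable abbrev act (A : Mat2) : Plane →L[ℝ] Plane :=
  Matrix.toEuclideanCLM (n := Fin 2) (𝕜 := ℝ) A

theorem act_apply (A : Mat2) (x : Plane) (i : Fin 2) :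
    act A x i = A i 0 * x 0 + A i 1 * x 1 := by
  rw [act, Matrix.ofLp_toEuclideanCLM, Matrix.mulVec, dotProduct, Fin.sum_univ_two]

theorem act_mul (A B : Mat2) : act (A * B) = (act A).comp (act B) :=
  map_mul Matrix.toEuclideanCLM A B

theorem act_mul_apply (A B : Mat2) (x : Plane) : act (A * B) x = act A (act B x) := by
  rw [act_mul]; rfl

theorem act_one : act 1 = ContinuousLinearMap.id ℝ Plane :=
  map_one Matrix.toEuclideanCLM

theorem act_act_of_mul_eq_one {A B : Mat2} (h : A * B = 1) (x : Plane) : act A (act B x) = x := by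
  rw [← act_mul_apply, h, act_one]; rfl

theorem det_act (A : Mat2) : (act A).det = A.det := by
  change LinearMap.det (Matrix.toLpLin 2 2 A) = A.det
  rw [Matrix.toLpLin_eq_toLin, LinearMap.det_toLin]

theorem grad_of_hasFDerivAt {φ : Plane → Plane} {A : Mat2} {x : Plane}
    (h : HasFDerivAt φ (act A) x) : grad φ x = A := by
  ext i j
  fin_cases j <;> simp [grad, h.fderiv, act_apply]

theorem hasFDerivAt_grad {φ : Plane → Plane} {x : Plane} (h : DifferentiableAt ℝ φ x) :
    HasFDerivAt φ (act (grad φ x)) x := by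
  obtain ⟨A, hA⟩ : ∃ A, act A = fderiv ℝ φ x :=
    (Matrix.toEuclideanCLM (n := Fin 2) (𝕜 := ℝ)).surjective _
  have h' : HasFDerivAt φ (act A) x := hA ▸ h.hasFDerivAt
  rwa [grad_of_hasFDerivAt h']

theorem grad_comp {u φ : Plane → Plane} {x : Plane} (hu : DifferentiableAt ℝ u (φ x))
    (hφ : DifferentiableAt ℝ φ x) : grad (u ∘ φ) x = grad u (φ x) * grad φ x := by
  apply grad_of_hasFDerivAt
  rw [act_mul]
  exact (hasFDerivAt_grad hu).comp x (hasFDerivAt_grad hφ)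

theorem grad_congr {u φ : Plane → Plane} {x : Plane} (h : u =ᶠ[𝓝 x] φ) :
    grad u x = grad φ x := by
  simp [grad, h.fderiv_eq]

theorem grad_affine (A : Mat2) (p q x : Plane) : grad (fun y => p + act A (y - q)) x = A := by
  apply grad_of_hasFDerivAt
  exact ((act A).hasFDerivAt.comp x ((hasFDerivAt_id x).sub_const q)).const_add p

theorem grad_id (x : Plane) : grad (fun y => y) x = 1 := by
  apply grad_of_hasFDerivAt
  rw [act_one]
  exact hasFDerivAt_id x

theorem continuous_grad {φ : Plane → Plane} (h : ContDiff ℝ ∞ φ) : Continuous (grad φ) := by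
  have h1 : Continuous (fderiv ℝ φ) := h.continuous_fderiv (by simp)
  refine continuous_matrix fun i j => ?_
  exact (EuclideanSpace.proj (𝕜 := ℝ) i).continuous.comp (h1.clm_apply continuous_const)

/-! ### Compactly supported diffeomorphisms -/

namespace IsCompactDiffeo

variable {M : Set Mat2} {Ω : Set Plane} {φ u : Plane → Plane}

theorem differentiable (h : IsCompactDiffeo M Ω φ) : Differentiable ℝ φ :=
  h.smooth.differentiable (by simp)

theorem injective (h : IsCompactDiffeo M Ω φ) : Function.Injective φ := by
  obtain ⟨ψ, -, hl, -⟩ := h.smooth_inverse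
  exact hl.injective

theorem eq_self (_h : IsCompactDiffeo M Ω φ) {x : Plane}
    (hx : x ∉ tsupport fun x => φ x - x) : φ x = x :=
  sub_eq_zero.1 (image_eq_zero_of_notMem_tsupport (f := fun x => φ x - x) hx)

theorem mono_left {M' : Set Mat2} (h : IsCompactDiffeo M Ω φ) (hM : M ⊆ M') :
    IsCompactDiffeo M' Ω φ :=
  { h with grad_mem := fun x => hM (h.grad_mem x) }

/-- A compactly supported diffeomorphism preserves its support. -/
theorem map_tsupport (h : IsCompactDiffeo M Ω φ) {x : Plane}
    (hx : x ∈ tsupport fun x => φ x - x) : φ x ∈ tsupport fun x => φ x - x := by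
  by_contra hc
  exact hc ((h.injective (h.eq_self hc)).symm ▸ hx)

theorem eventuallyEq_id (h : IsCompactDiffeo M Ω φ) {x : Plane}
    (hx : x ∉ tsupport fun x => φ x - x) : φ =ᶠ[𝓝 x] fun y => y := by
  filter_upwards [(isClosed_tsupport _).isOpen_compl.mem_nhds hx] with y hy
  exact h.eq_self hy

theorem comp (hM : ∀ A ∈ M, ∀ B ∈ M, A * B ∈ M) (hu : IsCompactDiffeo M Ω u)
    (hφ : IsCompactDiffeo M Ω φ) : IsCompactDiffeo M Ω (u ∘ φ) := by
  have hsub : (tsupport fun x => (u ∘ φ) x - x) ⊆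
      (tsupport fun x => u x - x) ∪ tsupport fun x => φ x - x := by
    refine closure_minimal (fun x hx => ?_) ((isClosed_tsupport _).union (isClosed_tsupport _))
    by_contra hc
    rw [mem_union, not_or] at hc
    refine hx ?_
    change u (φ x) - x = 0
    rw [hφ.eq_self hc.2, hu.eq_self hc.1, sub_self]
  refine ⟨hu.smooth.comp hφ.smooth, ?_, fun x => ?_, ?_, ?_⟩
  · obtain ⟨ψ, h1, h2, h3⟩ := hu.smooth_inverse
    obtain ⟨χ, k1, k2, k3⟩ := hφ.smooth_inverse
    exact ⟨χ ∘ ψ, k1.comp h1, h2.comp k2, h3.comp k3⟩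
  · rw [grad_comp (hu.differentiable _) (hφ.differentiable _)]
    exact hM _ (hu.grad_mem _) _ (hφ.grad_mem _)
  · exact (IsCompact.union hu.hasCompactSupport hφ.hasCompactSupport).of_isClosed_subset
      (isClosed_tsupport _) hsub
  · exact hsub.trans (union_subset hu.support_subset hφ.support_subset)

end IsCompactDiffeo

theorem mul_mem_SL2 : ∀ A ∈ SL2, ∀ B ∈ SL2, A * B ∈ SL2 := fun A hA B hB => by
  simp only [SL2, mem_ofPred_eq] at *
  rw [Matrix.det_mul, hA, hB, one_mul]

theorem mul_mem_GL2 : ∀ A ∈ GL2, ∀ B ∈ GL2, A * B ∈ GL2 := fun A hA B hB => by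
  simp only [GL2, mem_ofPred_eq] at *
  rw [Matrix.det_mul]
  exact mul_pos hA hB

theorem SL2_subset_GL2 : SL2 ⊆ GL2 := fun A hA => by
  simp only [SL2, GL2, mem_ofPred_eq] at *
  rw [hA]; exact one_pos

theorem det_conj {A B : Mat2} (hAB : A * B = 1) (F : Mat2) : (A * F * B).det = F.det := by
  have h : A.det * B.det = 1 := by rw [← Matrix.det_mul, hAB, Matrix.det_one]
  rw [Matrix.det_mul, Matrix.det_mul]
  linear_combination F.det * h

/-- A set of matrices stable under conjugation by invertible matrices. -/
def ConjInvariant (M : Set Mat2) : Prop :=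
  ∀ ⦃A B : Mat2⦄, A * B = 1 → ∀ ⦃F : Mat2⦄, F ∈ M → A * F * B ∈ M

theorem conjInvariant_SL2 : ConjInvariant SL2 := fun _ _ hAB _ hF => (det_conj hAB _).trans hF

theorem conjInvariant_GL2 : ConjInvariant GL2 := fun _ _ hAB _ hF =>
  lt_of_lt_of_eq hF (det_conj hAB _).symm

/-- The conjugate of `φ` by the affine map `y ↦ x₀ + A y`; here `B` plays the role of `A⁻¹`. -/
noncomputable def affineConj (A B : Mat2) (x₀ : Plane) (φ : Plane → Plane) (x : Plane) : Plane :=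
  x₀ + act A (φ (act B (x - x₀)))

theorem grad_affineConj (A B : Mat2) (x₀ : Plane) {φ : Plane → Plane} (hφ : Differentiable ℝ φ)
    (x : Plane) : grad (affineConj A B x₀ φ) x = A * grad φ (act B (x - x₀)) * B := by
  apply grad_of_hasFDerivAt
  rw [act_mul, act_mul]
  exact ((act A).hasFDerivAt.comp x ((hasFDerivAt_grad (hφ _)).comp x
    ((act B).hasFDerivAt.comp x ((hasFDerivAt_id x).sub_const x₀)))).const_add x₀

theorem isCompactDiffeo_affineConj {A B : Mat2} (hAB : A * B = 1) {x₀ : Plane}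
    {M : Set Mat2} (hM : ConjInvariant M)
    {Ω Ω' : Set Plane} {φ : Plane → Plane} (hφ : IsCompactDiffeo M Ω φ)
    (hΩ : ∀ y ∈ tsupport (fun x => φ x - x), x₀ + act A y ∈ Ω') :
    IsCompactDiffeo M Ω' (affineConj A B x₀ φ) := by
  have hBA : B * A = 1 := mul_eq_one_comm.1 hAB
  have smooth : ∀ ψ : Plane → Plane, ContDiff ℝ ∞ ψ → ContDiff ℝ ∞ (affineConj A B x₀ ψ) :=
    fun ψ hψ => contDiff_const.add ((act A).contDiff.comp (hψ.comp
      ((act B).contDiff.comp (contDiff_id.sub contDiff_const))))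
  have inv : ∀ ψ χ : Plane → Plane, Function.LeftInverse ψ χ →
      Function.LeftInverse (affineConj A B x₀ ψ) (affineConj A B x₀ χ) := fun ψ χ h x => by
    simp only [affineConj, add_sub_cancel_left]
    rw [act_act_of_mul_eq_one hBA, h, act_act_of_mul_eq_one hAB, add_sub_cancel]
  set K := tsupport fun x => φ x - x
  have hK : IsCompact ((fun y => x₀ + act A y) '' K) :=
    IsCompact.image hφ.hasCompactSupport (continuous_const.add (act A).continuous)
  have hsub : (tsupport fun x => affineConj A B x₀ φ x - x) ⊆ (fun y => x₀ + act A y) '' K := by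
    refine closure_minimal (fun x hx => ?_) hK.isClosed
    refine ⟨act B (x - x₀), ?_, ?_⟩
    · by_contra hc
      refine hx ?_
      change affineConj A B x₀ φ x - x = 0
      rw [affineConj, hφ.eq_self hc, act_act_of_mul_eq_one hAB, add_sub_cancel, sub_self]
    · simp only
      rw [act_act_of_mul_eq_one hAB, add_sub_cancel]
  refine ⟨smooth φ hφ.smooth, ?_, fun x => ?_, ?_, ?_⟩
  · obtain ⟨ψ, h1, h2, h3⟩ := hφ.smooth_inverse
    exact ⟨_, smooth ψ h1, inv _ _ h2, inv _ _ h3⟩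
  · rw [grad_affineConj A B x₀ hφ.differentiable]
    exact hM hAB (hφ.grad_mem _)
  · exact hK.of_isClosed_subset (isClosed_tsupport _) hsub
  · rintro x hx
    obtain ⟨y, hy, rfl⟩ := hsub hx
    exact hΩ y hy

/-- Every compactly supported diffeomorphism can be shrunk into a given neighbourhood by
conjugating it with a small multiple of a given linear map. -/
theorem exists_affineConj_scaled {A B : Mat2} (hAB : A * B = 1) {M : Set Mat2}
    (hM : ConjInvariant M) {x₀ : Plane} {Ω U : Set Plane} (hU : U ∈ 𝓝 x₀) {φ : Plane → Plane}
    (hφ : IsCompactDiffeo M Ω φ) :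
    ∃ ε : ℝ, 0 < ε ∧ (ε • A) * (ε⁻¹ • B) = 1 ∧
      IsCompactDiffeo M U (affineConj (ε • A) (ε⁻¹ • B) x₀ φ) := by
  have hK : IsCompact (act A '' tsupport fun x => φ x - x) :=
    IsCompact.image hφ.hasCompactSupport (act A).continuous
  obtain ⟨R, hR, hKR⟩ := hK.isBounded.exists_pos_norm_le
  obtain ⟨r, hr, hrU⟩ := Metric.mem_nhds_iff.1 hU
  have hε : 0 < r / (2 * R) := by positivity
  have h1 : ((r / (2 * R)) • A) * ((r / (2 * R))⁻¹ • B) = 1 := by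
    rw [Matrix.smul_mul, Matrix.mul_smul, smul_smul, mul_inv_cancel₀ hε.ne', one_smul, hAB]
  refine ⟨r / (2 * R), hε, h1, isCompactDiffeo_affineConj h1 hM hφ fun y hy => hrU ?_⟩
  rw [Metric.mem_ball, dist_eq_norm, add_sub_cancel_left]
  have h2 : act ((r / (2 * R)) • A) y = (r / (2 * R)) • act A y := by
    rw [act, map_smul]; rfl
  rw [h2, norm_smul, Real.norm_of_nonneg hε.le]
  calc r / (2 * R) * ‖act A y‖ ≤ r / (2 * R) * R := by
        gcongr; exact hKR _ (mem_image_of_mem _ hy)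
    _ = r / 2 := by field_simp
    _ < r := by linarith

/-! ### Twist maps -/

/-- The squared Euclidean norm, in coordinates. -/
noncomputable def normSqCoord (x : Plane) : ℝ := x 0 ^ 2 + x 1 ^ 2

/-- A smooth function on the line equal to `1` on `(-∞, 1]` and to `0` on `[2, ∞)`. -/
noncomputable def profile (r : ℝ) : ℝ := Real.smoothTransition (2 - r)

/-- The radial cutoff `profile (|x|²)`. -/
noncomputable def cutoff (x : Plane) : ℝ := profile (normSqCoord x)

/-- The radial derivative `profile' (|x|²)`, so that `∂ⱼ cutoff = 2 xⱼ cutoffDeriv`. -/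
noncomputable def cutoffDeriv (x : Plane) : ℝ := deriv profile (normSqCoord x)

/-- The twist of the plane which rotates `x` by the angle `s * cutoff x`. As the angle is
constant on circles, it is area preserving. -/
noncomputable def twist (s : ℝ) (x : Plane) : Plane :=
  !₂[Real.cos (s * cutoff x) * x 0 - Real.sin (s * cutoff x) * x 1,
    Real.sin (s * cutoff x) * x 0 + Real.cos (s * cutoff x) * x 1]

/-- The gradient of `twist s`. -/
noncomputable def twistGrad (s : ℝ) (x : Plane) : Mat2 :=
  let c := Real.cos (s * cutoff x)
  let d := Real.sin (s * cutoff x)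
  let e := s * (2 * cutoffDeriv x)
  !![c - e * x 0 * (d * x 0 + c * x 1), -d - e * x 1 * (d * x 0 + c * x 1);
    d + e * x 0 * (c * x 0 - d * x 1), c + e * x 1 * (c * x 0 - d * x 1)]

/-- The rotation matrix by the angle `s`. -/
noncomputable def rot (s : ℝ) : Mat2 := !![Real.cos s, -Real.sin s; Real.sin s, Real.cos s]

theorem contDiff_profile : ContDiff ℝ ∞ profile :=
  (Real.smoothTransition.contDiff (n := ⊤)).comp (contDiff_const.sub contDiff_id)

theorem profile_of_le {r : ℝ} (h : r ≤ 1) : profile r = 1 :=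
  Real.smoothTransition.one_of_one_le (by linarith)

theorem profile_of_ge {r : ℝ} (h : 2 ≤ r) : profile r = 0 :=
  Real.smoothTransition.zero_of_nonpos (by linarith)

theorem contDiff_coord (i : Fin 2) : ContDiff ℝ ∞ fun x : Plane => x i :=
  (EuclideanSpace.proj (𝕜 := ℝ) i).contDiff

theorem contDiff_normSqCoord : ContDiff ℝ ∞ normSqCoord :=
  ((contDiff_coord 0).pow 2).add ((contDiff_coord 1).pow 2)

theorem contDiff_cutoff : ContDiff ℝ ∞ cutoff := contDiff_profile.comp contDiff_normSqCoord

theorem continuous_cutoffDeriv : Continuous cutoffDeriv :=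
  (contDiff_profile.continuous_deriv (by simp)).comp contDiff_normSqCoord.continuous

theorem norm_sq_eq_normSqCoord (x : Plane) : ‖x‖ ^ 2 = normSqCoord x := by
  rw [EuclideanSpace.real_norm_sq_eq, Fin.sum_univ_two, normSqCoord]

theorem cutoff_eventuallyEq_one : cutoff =ᶠ[𝓝 0] fun _ => 1 := by
  filter_upwards [Metric.ball_mem_nhds (0 : Plane) one_pos] with x hx
  rw [mem_ball_zero_iff] at hx
  refine profile_of_le ?_
  rw [← norm_sq_eq_normSqCoord]
  exact pow_le_one₀ (norm_nonneg x) hx.le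

theorem cutoff_eq_zero {x : Plane} (hx : x ∉ Metric.closedBall (0 : Plane) 2) : cutoff x = 0 := by
  rw [mem_closedBall_zero_iff, not_le] at hx
  refine profile_of_ge ?_
  rw [← norm_sq_eq_normSqCoord]
  nlinarith

theorem contDiff_twist (s : ℝ) : ContDiff ℝ ∞ (twist s) := by
  have h := contDiff_const (c := s).mul contDiff_cutoff
  have h0 := contDiff_coord 0
  have h1 := contDiff_coord 1
  rw [contDiff_euclidean]
  intro i
  fin_cases i
  · exact ((Real.contDiff_cos.comp h).mul h0).sub ((Real.contDiff_sin.comp h).mul h1)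
  · exact ((Real.contDiff_sin.comp h).mul h0).add ((Real.contDiff_cos.comp h).mul h1)

theorem normSqCoord_twist (s : ℝ) (x : Plane) : normSqCoord (twist s x) = normSqCoord x := by
  have h := Real.sin_sq_add_cos_sq (s * cutoff x)
  simp only [normSqCoord, twist, PiLp.toLp_apply, Matrix.cons_val_zero, Matrix.cons_val_one]
  linear_combination (x 0 ^ 2 + x 1 ^ 2) * h

theorem twist_neg_twist (s : ℝ) (x : Plane) : twist (-s) (twist s x) = x := by
  have hc : cutoff (twist s x) = cutoff x := by rw [cutoff, normSqCoord_twist, cutoff]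
  have h := Real.sin_sq_add_cos_sq (s * cutoff x)
  ext i
  rw [twist, hc]
  fin_cases i
  · simp [twist]
    linear_combination x 0 * h
  · simp [twist]
    linear_combination x 1 * h

theorem hasFDerivAt_twist (s : ℝ) (x : Plane) : HasFDerivAt (twist s) (act (twistGrad s x)) x := by
  have h0 : HasFDerivAt (fun x : Plane => x 0) (EuclideanSpace.proj (𝕜 := ℝ) (0 : Fin 2)) x :=
    (EuclideanSpace.proj (𝕜 := ℝ) (0 : Fin 2)).hasFDerivAt
  have h1 : HasFDerivAt (fun x : Plane => x 1) (EuclideanSpace.proj (𝕜 := ℝ) (1 : Fin 2)) x :=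
    (EuclideanSpace.proj (𝕜 := ℝ) (1 : Fin 2)).hasFDerivAt
  have hp : HasDerivAt profile (cutoffDeriv x) (normSqCoord x) :=
    ((contDiff_profile.differentiable (by simp)) _).hasDerivAt
  have hq : HasFDerivAt normSqCoord _ x := (h0.pow 2).add (h1.pow 2)
  have hη : HasFDerivAt (fun x => s * cutoff x) _ x := (hp.comp_hasFDerivAt x hq).const_mul s
  rw [← hasFDerivWithinAt_univ, hasFDerivWithinAt_euclidean]
  intro i
  fin_cases i
  · rw [hasFDerivWithinAt_univ]
    refine ((hη.cos.mul h0).sub (hη.sin.mul h1)).congr_fderiv (ContinuousLinearMap.ext fun v => ?_)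
    change _ = act (twistGrad s x) v 0
    rw [act_apply]
    simp [twistGrad]
    ring
  · rw [hasFDerivWithinAt_univ]
    refine ((hη.sin.mul h0).add (hη.cos.mul h1)).congr_fderiv (ContinuousLinearMap.ext fun v => ?_)
    change _ = act (twistGrad s x) v 1
    rw [act_apply]
    simp [twistGrad]
    ring

theorem grad_twist (s : ℝ) (x : Plane) : grad (twist s) x = twistGrad s x :=
  grad_of_hasFDerivAt (hasFDerivAt_twist s x)

theorem twistGrad_mem_SL2 (s : ℝ) (x : Plane) : twistGrad s x ∈ SL2 := by
  have h := Real.sin_sq_add_cos_sq (s * cutoff x)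
  change Matrix.det _ = 1
  simp only [twistGrad, Matrix.det_fin_two_of]
  linear_combination h

theorem isCompactDiffeo_twist (s : ℝ) : IsCompactDiffeo SL2 univ (twist s) := by
  have hsub : (tsupport fun x => twist s x - x) ⊆ Metric.closedBall (0 : Plane) 2 := by
    refine closure_minimal (fun x hx => ?_) Metric.isClosed_closedBall
    by_contra hc
    refine hx ?_
    change twist s x - x = 0
    rw [sub_eq_zero]
    ext i
    fin_cases i <;> simp [twist, cutoff_eq_zero hc]
  refine ⟨contDiff_twist s, ⟨twist (-s), contDiff_twist _, twist_neg_twist s, fun x => ?_⟩,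
    fun x => ?_, ?_, subset_univ _⟩
  · simpa using twist_neg_twist (-s) x
  · rw [grad_twist]; exact twistGrad_mem_SL2 s x
  · exact (isCompact_closedBall (0 : Plane) 2).of_isClosed_subset (isClosed_tsupport _) hsub

theorem twist_eventuallyEq (s : ℝ) : twist s =ᶠ[𝓝 0] fun x => act (rot s) x := by
  filter_upwards [cutoff_eventuallyEq_one] with x hx
  ext i
  rw [act_apply]
  fin_cases i
  · simp [twist, rot, hx]; ring
  · simp [twist, rot, hx]

/-! ### Prescribing the gradient near a point -/

/-- The matrices `F` for which some compactly supported diffeomorphism of `Ω` with gradient in `M`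
coincides near `x₀` with the affine map `x ↦ x₀ + F (x - x₀)`. -/
def localGradients (M : Set Mat2) (Ω : Set Plane) (x₀ : Plane) : Set Mat2 :=
  {F | ∃ u, IsCompactDiffeo M Ω u ∧ u =ᶠ[𝓝 x₀] fun x => x₀ + act F (x - x₀)}

section localGradients

variable {M : Set Mat2} {Ω : Set Plane} {x₀ : Plane}

theorem mul_mem_localGradients (hM : ∀ A ∈ M, ∀ B ∈ M, A * B ∈ M) {F G : Mat2}
    (hF : F ∈ localGradients M Ω x₀) (hG : G ∈ localGradients M Ω x₀) :
    F * G ∈ localGradients M Ω x₀ := by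
  obtain ⟨u, hu, hu'⟩ := hF
  obtain ⟨v, hv, hv'⟩ := hG
  refine ⟨u ∘ v, hu.comp hM hv, ?_⟩
  have hv0 : v x₀ = x₀ := by simpa using hv'.self_of_nhds
  have ht : Tendsto v (𝓝 x₀) (𝓝 x₀) := by
    simpa [hv0] using hv.smooth.continuous.tendsto x₀
  filter_upwards [hv', ht.eventually hu'] with x h1 h2
  rw [Function.comp_apply, h2, h1, add_sub_cancel_left, act_mul_apply]

theorem pow_mem_localGradients (hM : ∀ A ∈ M, ∀ B ∈ M, A * B ∈ M) {F : Mat2}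
    (hF : F ∈ localGradients M Ω x₀) (n : ℕ) : F ^ (n + 1) ∈ localGradients M Ω x₀ := by
  induction n with
  | zero => simpa using hF
  | succ n ih => rw [pow_succ]; exact mul_mem_localGradients hM ih hF

theorem conj_rot_mem_localGradients (hΩ : Ω ∈ 𝓝 x₀) {A B : Mat2} (hAB : A * B = 1) (s : ℝ) :
    A * rot s * B ∈ localGradients SL2 Ω x₀ := by
  obtain ⟨ε, hε, h1, h2⟩ := exists_affineConj_scaled hAB conjInvariant_SL2 hΩ
    (isCompactDiffeo_twist s)
  refine ⟨_, h2, ?_⟩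
  have ht : Tendsto (fun x => act (ε⁻¹ • B) (x - x₀)) (𝓝 x₀) (𝓝 0) := by
    have : Continuous fun x => act (ε⁻¹ • B) (x - x₀) := by fun_prop
    simpa using this.tendsto x₀
  filter_upwards [ht.eventually (twist_eventuallyEq s)] with x hx
  rw [affineConj, hx, ← act_mul_apply, ← act_mul_apply]
  congr 3
  rw [Matrix.smul_mul, Matrix.smul_mul, Matrix.mul_smul, smul_smul, mul_inv_cancel₀ hε.ne',
    one_smul]

end localGradients

/-- The upper shear. -/
def upperShear (t : ℝ) : Mat2 := !![1, t; 0, 1]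

/-- The lower shear. -/
def lowerShear (t : ℝ) : Mat2 := !![1, 0; t, 1]

theorem upperShear_mem_SL2 (t : ℝ) : upperShear t ∈ SL2 := by
  simp [SL2, upperShear]

theorem lowerShear_mem_SL2 (t : ℝ) : lowerShear t ∈ SL2 := by
  simp [SL2, lowerShear]

theorem upperShear_mul (s t : ℝ) : upperShear s * upperShear t = upperShear (s + t) := by
  simp [upperShear, add_comm]

/-- A unimodular matrix whose lower left entry is not zero is a product of three shears. -/
theorem eq_shear_mul_shear_mul_shear {F : Mat2} (hF : F ∈ SL2) (h : F 1 0 ≠ 0) :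
    F = upperShear ((F 0 0 - 1) / F 1 0) * lowerShear (F 1 0) *
      upperShear ((F 1 1 - 1) / F 1 0) := by
  have hd : F 0 0 * F 1 1 - F 0 1 * F 1 0 = 1 := by rw [← Matrix.det_fin_two]; exact hF
  ext i j
  fin_cases i <;> fin_cases j <;> simp [upperShear, lowerShear] <;> field_simp
  · ring
  · linear_combination -hd
  · ring

theorem rot_pi_div_two : rot (Real.pi / 2) = !![0, -1; 1, 0] := by simp [rot]

theorem rot_neg_pi_div_two : rot (-(Real.pi / 2)) = !![0, 1; -1, 0] := by simp [rot]

/-- Every unimodular matrix is the gradient near `x₀` of an area preserving diffeomorphism: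
conjugates of rotations generate `SL₂`. -/
theorem localGradients_SL2 {Ω : Set Plane} {x₀ : Plane} (hΩ : Ω ∈ 𝓝 x₀) {F : Mat2}
    (hF : F ∈ SL2) : F ∈ localGradients SL2 Ω x₀ := by
  have mul {F G : Mat2} := mul_mem_localGradients (Ω := Ω) (x₀ := x₀) (F := F) (G := G) mul_mem_SL2
  -- Conjugates of `diag (r, 1/r)` are products of two conjugates of quarter turns.
  have diag : ∀ A B : Mat2, A * B = 1 → ∀ r : ℝ, r ≠ 0 →
      A * !![r, 0; 0, r⁻¹] * B ∈ localGradients SL2 Ω x₀ := fun A B hAB r hr => by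
    have hD : !![r, 0; 0, 1] * !![r⁻¹, 0; 0, 1] = (1 : Mat2) := by
      rw [Matrix.mul_fin_two, Matrix.one_fin_two]; simp [hr]
    have hBA : B * A = 1 := mul_eq_one_comm.1 hAB
    have h1 : (A * !![r, 0; 0, 1]) * (!![r⁻¹, 0; 0, 1] * B) = 1 := by
      rw [Matrix.mul_assoc, ← Matrix.mul_assoc _ _ B, hD, Matrix.one_mul, hAB]
    convert mul (conj_rot_mem_localGradients hΩ h1 (Real.pi / 2))
      (conj_rot_mem_localGradients hΩ hAB (-(Real.pi / 2))) using 1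
    have h2 : (!![r, 0; 0, r⁻¹] : Mat2) = !![r, 0; 0, 1] * rot (Real.pi / 2) *
        !![r⁻¹, 0; 0, 1] * rot (-(Real.pi / 2)) := by
      rw [rot_pi_div_two, rot_neg_pi_div_two]
      simp
    calc A * !![r, 0; 0, r⁻¹] * B
        = A * !![r, 0; 0, 1] * rot (Real.pi / 2) * !![r⁻¹, 0; 0, 1] * 1 *
          rot (-(Real.pi / 2)) * B := by rw [h2]; simp only [Matrix.mul_assoc, Matrix.one_mul]
      _ = _ := by rw [← hBA]; simp only [Matrix.mul_assoc]
  -- The commutator of `diag (2, 1/2)` and a shear is a shear.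
  have upper : ∀ t, upperShear t ∈ localGradients SL2 Ω x₀ := fun t => by
    have hU : upperShear (t / 3) * upperShear (-(t / 3)) = 1 := by
      rw [upperShear_mul, Matrix.one_fin_two]; simp [upperShear]
    have h1 := diag 1 1 (Matrix.one_mul 1) 2 two_ne_zero
    have h2 := diag _ _ hU 2⁻¹ (by norm_num)
    convert mul h1 h2 using 1
    ext i j
    fin_cases i <;> fin_cases j <;> simp [upperShear]
    ring
  have lower : ∀ t, lowerShear t ∈ localGradients SL2 Ω x₀ := fun t => by
    have hL : lowerShear (t / 3) * lowerShear (-(t / 3)) = 1 := by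
      simp [lowerShear, Matrix.one_fin_two]
    have h1 := diag 1 1 (Matrix.one_mul 1) 2⁻¹ (by norm_num)
    have h2 := diag _ _ hL 2 two_ne_zero
    convert mul h1 h2 using 1
    ext i j
    fin_cases i <;> fin_cases j <;> simp [lowerShear]
    ring
  have generic : ∀ G ∈ SL2, G 1 0 ≠ 0 → G ∈ localGradients SL2 Ω x₀ := fun G hG h => by
    rw [eq_shear_mul_shear_mul_shear hG h]
    exact mul (mul (upper _) (lower _)) (upper _)
  by_cases h : F 1 0 = 0
  · have h3 : lowerShear (-1) * (lowerShear 1 * F) = F := by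
      rw [← Matrix.mul_assoc]
      simp [lowerShear, ← Matrix.one_fin_two]
    rw [← h3]
    refine mul (lower _) (generic _ (mul_mem_SL2 _ (lowerShear_mem_SL2 1) _ hF) ?_)
    have hd : F 0 0 * F 1 1 - F 0 1 * F 1 0 = 1 := by rw [← Matrix.det_fin_two]; exact hF
    simp only [lowerShear, Matrix.mul_apply, Fin.sum_univ_two, h]
    intro h0
    simp at h0
    simp [h0, h] at hd
  · exact generic F hF h

/-- A map which stretches a neighbourhood of the origin by the factor `1 + t`, and is the identity
far away. -/
noncomputable def stretch (t : ℝ) (x : Plane) : Plane := x + t • (cutoff x • x)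

/-- For small `t` the map `stretch t` is a small Lipschitz perturbation of the identity, hence a
diffeomorphism. -/
theorem exists_isCompactDiffeo_stretch :
    ∃ δ : ℝ, 0 < δ ∧ ∀ t : ℝ, |t| < δ → IsCompactDiffeo GL2 univ (stretch t) := by
  set v : Plane → Plane := fun x => cutoff x • x with hv_def
  have hv : ContDiff ℝ ∞ v := contDiff_cutoff.smul contDiff_id
  have hvs : HasCompactSupport v := by
    refine HasCompactSupport.intro (isCompact_closedBall (0 : Plane) 2) fun x hx => ?_
    rw [hv_def]
    simp only [cutoff_eq_zero hx, zero_smul]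
  obtain ⟨C, hC⟩ := hv.lipschitzWith_of_hasCompactSupport hvs (by simp)
  refine ⟨1 / (4 * (C + 1)), by positivity, fun t ht => ?_⟩
  have htC : |t| * C ≤ 1 / 4 := by
    rw [lt_div_iff₀ (by positivity)] at ht
    have := abs_nonneg t
    nlinarith
  have hsmooth : ContDiff ℝ ∞ (stretch t) := contDiff_id.add (hv.const_smul t)
  have hderiv : ∀ x, HasFDerivAt (stretch t)
      (ContinuousLinearMap.id ℝ Plane + t • fderiv ℝ v x) x := fun x =>
    (hasFDerivAt_id x).add (((hv.differentiable (by simp)) x).hasFDerivAt.const_smul t)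
  have hbound : ∀ x i j, |t * fderiv ℝ v x (EuclideanSpace.single j 1) i| ≤ 1 / 4 := by
    intro x i j
    rw [abs_mul]
    refine le_trans ?_ htC
    gcongr
    calc |fderiv ℝ v x (EuclideanSpace.single j 1) i|
        ≤ ‖fderiv ℝ v x (EuclideanSpace.single j 1)‖ :=
          PiLp.norm_apply_le (fderiv ℝ v x (EuclideanSpace.single j 1)) i
      _ ≤ ‖fderiv ℝ v x‖ * ‖(EuclideanSpace.single j 1 : Plane)‖ :=
          ContinuousLinearMap.le_opNorm _ _
      _ ≤ C := by simpa using norm_fderiv_le_of_lipschitz ℝ hC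
  have hgrad : ∀ x, grad (stretch t) x ∈ GL2 := fun x => by
    have h00 := abs_le.1 (hbound x 0 0)
    have h01 := abs_le.1 (hbound x 0 1)
    have h10 := abs_le.1 (hbound x 1 0)
    have h11 := abs_le.1 (hbound x 1 1)
    change 0 < (grad (stretch t) x).det
    rw [Matrix.det_fin_two]
    simp [grad, (hderiv x).fderiv]
    nlinarith
  have happrox : ApproximatesLinearOn (stretch t)
      ((ContinuousLinearEquiv.refl ℝ Plane : Plane ≃L[ℝ] Plane) : Plane →L[ℝ] Plane) univ
      (‖t‖₊ * C) := by
    intro x _ y _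
    have h1 : stretch t x - stretch t y -
        ((ContinuousLinearEquiv.refl ℝ Plane : Plane ≃L[ℝ] Plane) : Plane →L[ℝ] Plane) (x - y) =
        t • (v x - v y) := by
      simp only [stretch, hv_def, ContinuousLinearEquiv.coe_refl, ContinuousLinearMap.coe_id', id]
      module
    rw [h1, norm_smul, NNReal.coe_mul, mul_assoc]
    gcongr
    · simp
    · exact hC.norm_sub_le x y
  let e : Plane ≃ₜ Plane := happrox.toHomeomorph (stretch t) (Or.inr (by
    rw [← NNReal.coe_lt_coe]
    simp
    have : ‖ContinuousLinearMap.id ℝ Plane‖ = 1 := ContinuousLinearMap.norm_id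
    linarith))
  have he : ⇑e = stretch t := rfl
  have hinv : ContDiff ℝ ∞ e.symm := by
    have hdet : ∀ x, (act (grad (stretch t) x)).det ≠ 0 := fun x => by
      rw [det_act]
      exact (hgrad x).ne'
    refine e.contDiff_symm (f₀' := fun x =>
      ContinuousLinearMap.toContinuousLinearEquivOfDetNeZero _ (hdet x)) (fun x => ?_) hsmooth
    exact hasFDerivAt_grad (hsmooth.differentiable (by simp) x)
  have hsub : (fun x => stretch t x - x) = t • v := by
    ext1 x; simp [stretch, hv_def]
  refine ⟨hsmooth, ⟨e.symm, hinv, e.symm_apply_apply, e.apply_symm_apply⟩, hgrad, ?_,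
    subset_univ _⟩
  rw [hsub]
  exact hvs.smul_left

theorem exists_smul_one_mem_localGradients {Ω : Set Plane} {x₀ : Plane} (hΩ : Ω ∈ 𝓝 x₀) :
    ∃ δ : ℝ, 0 < δ ∧ ∀ t : ℝ, |t| < δ → (1 + t) • (1 : Mat2) ∈ localGradients GL2 Ω x₀ := by
  obtain ⟨δ, hδ, h⟩ := exists_isCompactDiffeo_stretch
  refine ⟨δ, hδ, fun t ht => ?_⟩
  obtain ⟨ε, hε, h1, h2⟩ := exists_affineConj_scaled (Matrix.one_mul (1 : Mat2))
    conjInvariant_GL2 hΩ (h t ht)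
  refine ⟨_, h2, ?_⟩
  have hc : Tendsto (fun x => act (ε⁻¹ • (1 : Mat2)) (x - x₀)) (𝓝 x₀) (𝓝 0) := by
    have : Continuous fun x => act (ε⁻¹ • (1 : Mat2)) (x - x₀) := by fun_prop
    simpa using this.tendsto x₀
  filter_upwards [hc.eventually cutoff_eventuallyEq_one] with x hx
  have h3 : stretch t (act (ε⁻¹ • (1 : Mat2)) (x - x₀)) =
      (1 + t) • act (ε⁻¹ • (1 : Mat2)) (x - x₀) := by
    rw [stretch, hx]; module
  rw [affineConj, h3, map_smul, act_act_of_mul_eq_one h1]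
  congr 1
  rw [act, map_smul, map_one]
  rfl

/-- Every positive multiple of a unimodular matrix is the gradient near `x₀` of a
diffeomorphism. -/
theorem smul_mem_localGradients_GL2 {Ω : Set Plane} {x₀ : Plane} (hΩ : Ω ∈ 𝓝 x₀) {r : ℝ}
    (hr : 0 < r) {F : Mat2} (hF : F ∈ SL2) : r • F ∈ localGradients GL2 Ω x₀ := by
  obtain ⟨δ, hδ, h⟩ := exists_smul_one_mem_localGradients hΩ
  -- A large root of `r` is close to `1`.
  have hlim : Tendsto (fun n : ℕ => r ^ (1 / ((n : ℝ) + 1))) atTop (𝓝 1) := by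
    have := tendsto_one_div_add_atTop_nhds_zero_nat (𝕜 := ℝ)
    simpa using (tendsto_const_nhds (x := r)).rpow this (Or.inl hr.ne')
  obtain ⟨n, hn⟩ := (Metric.tendsto_nhds.1 hlim δ hδ).exists
  have h1 := h (r ^ (1 / ((n : ℝ) + 1)) - 1) (by simpa [Real.dist_eq] using hn)
  have h2 := pow_mem_localGradients mul_mem_GL2 h1 n
  have h3 : (r ^ (1 / ((n : ℝ) + 1))) ^ (n + 1) = r := by
    rw [one_div]
    exact_mod_cast Real.rpow_inv_natCast_pow hr.le n.succ_ne_zero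
  rw [add_sub_cancel, smul_pow, one_pow, h3] at h2
  have h4 : F ∈ localGradients GL2 Ω x₀ := by
    obtain ⟨u, hu, hu'⟩ := localGradients_SL2 hΩ hF
    exact ⟨u, hu.mono_left SL2_subset_GL2, hu'⟩
  simpa using mul_mem_localGradients mul_mem_GL2 h2 h4

/-! ### Localisation of the invariance of the integral -/

theorem integral_eq_zero_of_integral_comp_affine {f : Plane → ℝ} {A B : Mat2} (hAB : A * B = 1)
    (x₀ : Plane) (h : ∫ x, f (act B (x - x₀)) = 0) : ∫ x, f x = 0 := by
  have hBA : B * A = 1 := mul_eq_one_comm.1 hAB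
  have hdet : B.det ≠ 0 := fun h0 => by
    have := congrArg Matrix.det hBA
    rw [Matrix.det_mul, h0, zero_mul, Matrix.det_one] at this
    exact zero_ne_one this
  let e : Plane ≃ₜ Plane :=
    { toFun := act B
      invFun := act A
      left_inv := act_act_of_mul_eq_one hAB
      right_inv := act_act_of_mul_eq_one hBA
      continuous_toFun := (act B).continuous
      continuous_invFun := (act A).continuous }
  have hd : LinearMap.det (act B : Plane →ₗ[ℝ] Plane) = B.det := det_act B
  have hmap := Measure.map_linearMap_addHaar_eq_smul_addHaar (volume : Measure Plane)
    (f := (act B : Plane →ₗ[ℝ] Plane)) (by rw [hd]; exact hdet)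
  have h1 : ∫ x, f x ∂(Measure.map e volume) = ∫ x, f (act B x) :=
    e.measurableEmbedding.integral_map f
  have hmap' : Measure.map e volume = ENNReal.ofReal |(B.det)⁻¹| • (volume : Measure Plane) := by
    rw [← hd]; exact hmap
  rw [integral_sub_right_eq_self (fun x => f (act B x)) x₀, ← h1, hmap', integral_smul_measure,
    ENNReal.toReal_ofReal (abs_nonneg _), smul_eq_mul] at h
  exact (mul_eq_zero.1 h).resolve_left (abs_ne_zero.2 (inv_ne_zero hdet))

theorem integrableOn_comp_grad {M : Set Mat2} {W : Mat2 → ℝ} (hW : ContinuousOn W M)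
    {Ω : Set Plane} (hΩ : Bornology.IsBounded Ω) {u : Plane → Plane}
    (hu : IsCompactDiffeo M Ω u) : IntegrableOn (fun x => W (grad u x)) Ω := by
  have hc : Continuous fun x => W (grad u x) :=
    hW.comp_continuous (continuous_grad hu.smooth) hu.grad_mem
  exact (hc.continuousOn.integrableOn_compact hΩ.isCompact_closure).mono_set subset_closure

/-- If precomposing `u` with area preserving diffeomorphisms of `Ω` does not change the energy, and
`u` has constant gradient `F` near a point, then the energy with density `W (F ·)` cannot
distinguish any compactly supported area preserving diffeomorphism of the plane, nor any of its
linear conjugates, from the identity: shrink it into the region where `u` is affine. -/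
theorem integral_conj_eq_zero {M : Set Mat2} (hM : ∀ A ∈ M, ∀ B ∈ M, A * B ∈ M) (hSL : SL2 ⊆ M)
    {W : Mat2 → ℝ} (hW : ContinuousOn W M) {Ω : Set Plane} (hΩ : Bornology.IsBounded Ω)
    {x₀ : Plane} (hx₀ : Ω ∈ 𝓝 x₀) {u : Plane → Plane} (hu : IsCompactDiffeo M Ω u) {F : Mat2}
    (huF : u =ᶠ[𝓝 x₀] fun x => x₀ + act F (x - x₀))
    (h : ∀ φ, IsCompactDiffeo SL2 Ω φ →
      ∫ x in Ω, W (grad (u ∘ φ) x) = ∫ x in Ω, W (grad u x))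
    {A B : Mat2} (hAB : A * B = 1) {φ : Plane → Plane} (hφ : IsCompactDiffeo SL2 univ φ) :
    ∫ x, (W (F * (A * grad φ x * B)) - W F) = 0 := by
  have hgradu : ∀ᶠ x in 𝓝 x₀, grad u x = F := by
    filter_upwards [huF.eventuallyEq_nhds] with x hx
    rw [grad_congr hx, grad_affine]
  obtain ⟨ε, hε, h1, h2⟩ := exists_affineConj_scaled hAB conjInvariant_SL2
    (inter_mem hx₀ hgradu) hφ
  set χ := affineConj (ε • A) (ε⁻¹ • B) x₀ φ with hχ
  set K := tsupport fun x => χ x - x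
  have hχΩ : IsCompactDiffeo SL2 Ω χ :=
    { h2 with support_subset := h2.support_subset.trans inter_subset_left }
  have hχM : IsCompactDiffeo M Ω χ := hχΩ.mono_left hSL
  have hpoint : ∀ x, W (F * grad χ x) - W F = W (grad (u ∘ χ) x) - W (grad u x) := fun x => by
    rw [grad_comp (hu.differentiable _) (hχΩ.differentiable _)]
    by_cases hx : x ∈ K
    · have e1 : grad u x = F := (h2.support_subset hx).2
      have e2 : grad u (χ x) = F := (h2.support_subset (h2.map_tsupport hx)).2
      rw [e1, e2]
    · rw [grad_congr (h2.eventuallyEq_id hx), grad_id, h2.eq_self hx, Matrix.mul_one,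
        Matrix.mul_one, sub_self, sub_self]
  have hzero : ∀ x ∉ Ω, W (F * grad χ x) - W F = 0 := fun x hx => by
    have hxK : x ∉ K := fun hxK => hx (hχΩ.support_subset hxK)
    rw [grad_congr (h2.eventuallyEq_id hxK), grad_id, Matrix.mul_one, sub_self]
  have hint : ∫ x, (W (F * grad χ x) - W F) = 0 := by
    rw [← setIntegral_eq_integral_of_forall_compl_eq_zero hzero]
    simp_rw [hpoint]
    rw [integral_sub (integrableOn_comp_grad hW hΩ (hu.comp hM hχM))
      (integrableOn_comp_grad hW hΩ hu), h χ hχΩ, sub_self]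
  refine integral_eq_zero_of_integral_comp_affine h1 x₀
    (f := fun y => W (F * (A * grad φ y * B)) - W F) ?_
  rw [← hint]
  congr 1
  ext x
  rw [hχ, grad_affineConj _ _ _ hφ.differentiable]
  congr 3
  rw [Matrix.smul_mul, Matrix.smul_mul, Matrix.mul_smul, smul_smul, mul_inv_cancel₀ hε.ne',
    one_smul]

/-! ### Concentration of twists into shears -/

/-- The amount of shear in the limit of stretched twists: the derivative of the rotational field
`-x₁ cutoff x` in the direction `x₁`. -/
noncomputable def shearProfile (x : Plane) : ℝ :=
  -cutoff x - 2 * cutoffDeriv x * x 1 ^ 2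

theorem cutoffDeriv_eq_zero {x : Plane} (hx : x ∉ Metric.closedBall (0 : Plane) 2) :
    cutoffDeriv x = 0 := by
  rw [mem_closedBall_zero_iff, not_le] at hx
  have h2 : 2 < normSqCoord x := by
    rw [← norm_sq_eq_normSqCoord]
    nlinarith
  have h : profile =ᶠ[𝓝 (normSqCoord x)] fun _ => 0 := by
    filter_upwards [Ioi_mem_nhds h2] with r hr
    exact profile_of_ge (le_of_lt hr)
  rw [cutoffDeriv, h.deriv_eq, deriv_const]

theorem continuous_coord (i : Fin 2) : Continuous fun x : Plane => x i :=
  (contDiff_coord i).continuous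

theorem continuous_shearProfile : Continuous shearProfile :=
  contDiff_cutoff.continuous.neg.sub
    ((continuous_const.mul continuous_cutoffDeriv).mul ((continuous_coord 1).pow 2))

theorem hasCompactSupport_shearProfile : HasCompactSupport shearProfile :=
  HasCompactSupport.intro (isCompact_closedBall (0 : Plane) 2) fun x hx => by
    rw [shearProfile, cutoff_eq_zero hx, cutoffDeriv_eq_zero hx]
    ring

theorem shearProfile_zero : shearProfile 0 = -1 := by
  simp [shearProfile, cutoff_eventuallyEq_one.self_of_nhds]

theorem continuous_upperShear : Continuous upperShear := by
  refine continuous_matrix fun i j => ?_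
  fin_cases i <;> fin_cases j <;> simp [upperShear] <;> fun_prop

/-- The gradient of the twist by the angle `t ε`, conjugated by `diag (1, ε)`. Writing
`sin y = y sinc y` makes the formula continuous up to `ε = 0`. -/
noncomputable def stretchedTwistGrad (t ε : ℝ) (x : Plane) : Mat2 :=
  let c := Real.cos (t * ε * cutoff x)
  let d := Real.sin (t * ε * cutoff x)
  let e := t * (2 * cutoffDeriv x)
  !![c - ε * e * x 0 * (d * x 0 + c * x 1),
      -(t * cutoff x * Real.sinc (t * ε * cutoff x)) - e * x 1 * (d * x 0 + c * x 1);
    ε * (d + ε * e * x 0 * (c * x 0 - d * x 1)), c + ε * e * x 1 * (c * x 0 - d * x 1)]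

theorem stretchedTwistGrad_eq (t : ℝ) {ε : ℝ} (hε : ε ≠ 0) (x : Plane) :
    stretchedTwistGrad t ε x = !![1, 0; 0, ε] * twistGrad (t * ε) x * !![1, 0; 0, ε⁻¹] := by
  have hs : t * ε * cutoff x * Real.sinc (t * ε * cutoff x) = Real.sin (t * ε * cutoff x) := by
    by_cases h : t * ε * cutoff x = 0
    · simp [h]
    · rw [Real.sinc_of_ne_zero h, mul_div_cancel₀ _ h]
  ext i j
  fin_cases i <;> fin_cases j <;>
    simp [stretchedTwistGrad, twistGrad, Matrix.mul_apply, Fin.sum_univ_two,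
      -mul_eq_mul_left_iff, -mul_eq_mul_right_iff]
  · ring
  · rw [← hs]
    field_simp
  · ring
  · field_simp

theorem stretchedTwistGrad_zero (t : ℝ) (x : Plane) :
    stretchedTwistGrad t 0 x = upperShear (t * shearProfile x) := by
  ext i j
  fin_cases i <;> fin_cases j <;> simp [stretchedTwistGrad, upperShear, shearProfile]
  ring

theorem diag_mul_diag_inv {ε : ℝ} (hε : ε ≠ 0) :
    (!![1, 0; 0, ε] : Mat2) * !![1, 0; 0, ε⁻¹] = 1 := by
  simp [hε, Matrix.one_fin_two]

theorem stretchedTwistGrad_mem_SL2 (t ε : ℝ) (x : Plane) : stretchedTwistGrad t ε x ∈ SL2 := by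
  by_cases hε : ε = 0
  · rw [hε, stretchedTwistGrad_zero]
    exact upperShear_mem_SL2 _
  · rw [stretchedTwistGrad_eq t hε]
    exact conjInvariant_SL2 (diag_mul_diag_inv hε) (twistGrad_mem_SL2 _ _)

theorem continuous_stretchedTwistGrad (t : ℝ) :
    Continuous fun p : ℝ × Plane => stretchedTwistGrad t p.1 p.2 := by
  have h0 : Continuous fun p : ℝ × Plane => p.2 0 := (continuous_coord 0).comp continuous_snd
  have h1 : Continuous fun p : ℝ × Plane => p.2 1 := (continuous_coord 1).comp continuous_snd
  have hη : Continuous fun p : ℝ × Plane => cutoff p.2 :=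
    contDiff_cutoff.continuous.comp continuous_snd
  have hδ : Continuous fun p : ℝ × Plane => cutoffDeriv p.2 :=
    continuous_cutoffDeriv.comp continuous_snd
  have hs := Real.continuous_sinc
  refine continuous_matrix fun i j => ?_
  fin_cases i <;> fin_cases j <;> simp [stretchedTwistGrad] <;> fun_prop

theorem stretchedTwistGrad_eq_one (t ε : ℝ) {x : Plane}
    (hx : x ∉ Metric.closedBall (0 : Plane) 2) : stretchedTwistGrad t ε x = 1 := by
  simp [stretchedTwistGrad, cutoff_eq_zero hx, cutoffDeriv_eq_zero hx, Matrix.one_fin_two]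

/-- A density which does not distinguish conjugated twists from the identity does not distinguish
the shears with profile `t * shearProfile` from the identity either. -/
theorem integral_upperShear_eq_zero {V : Mat2 → ℝ} (hV : ContinuousOn V SL2)
    (h : ∀ A B : Mat2, A * B = 1 → ∀ φ, IsCompactDiffeo SL2 univ φ →
      ∫ x, (V (A * grad φ x * B) - V 1) = 0) (t : ℝ) :
    ∫ x, (V (upperShear (t * shearProfile x)) - V 1) = 0 := by
  have hcont : Continuous fun ε => ∫ x, (V (stretchedTwistGrad t ε x) - V 1) := by
    rw [← continuousOn_univ]
    refine continuousOn_integral_of_compact_support (isCompact_closedBall (0 : Plane) 2) ?_ ?_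
    · exact ((hV.comp_continuous (continuous_stretchedTwistGrad t)
        fun p => stretchedTwistGrad_mem_SL2 t p.1 p.2).sub continuous_const).continuousOn
    · intro ε x _ hx
      rw [stretchedTwistGrad_eq_one t ε hx, sub_self]
  have hne : ∀ ε : ℝ, ε ≠ 0 → ∫ x, (V (stretchedTwistGrad t ε x) - V 1) = 0 := fun ε hε => by
    rw [← h _ _ (diag_mul_diag_inv hε) _ (isCompactDiffeo_twist (t * ε))]
    simp_rw [grad_twist, stretchedTwistGrad_eq t hε]
  have hall := hcont.ext_on (dense_compl_singleton (0 : ℝ)) continuous_const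
    (fun ε hε => hne ε hε)
  simpa only [stretchedTwistGrad_zero] using congrFun hall 0

/-! ### From vanishing averages to affine functions -/

section Averages

variable {m : Plane → ℝ} {g : ℝ → ℝ}

theorem hasCompactSupport_comp_sub (hms : HasCompactSupport m) (g : ℝ → ℝ) (τ t : ℝ) :
    HasCompactSupport fun x => g (τ + t * m x) - g τ :=
  hms.mono' fun x hx => by
    by_contra hc
    refine hx ?_
    simp [image_eq_zero_of_notMem_tsupport hc]

/-- A maximum principle: by the symmetric mean value property, the leftmost maximum point on
`[a, b]` cannot lie in the interior. -/
theorem nonpos_of_integral_symm_eq_zero (hm : Continuous m) (hms : HasCompactSupport m)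
    {p : Plane} (hp : m p ≠ 0) {k : ℝ → ℝ} (hk : Continuous k)
    (h : ∀ τ t, ∫ x, ((k (τ + t * m x) - k τ) + (k (τ + -t * m x) - k τ)) = 0)
    {a b : ℝ} (ha : k a = 0) (hb : k b = 0) {c : ℝ} (hc : c ∈ Icc a b) : k c ≤ 0 := by
  by_contra! hpos
  obtain ⟨z, hz, hzmax⟩ := isCompact_Icc.exists_isMaxOn ⟨c, hc⟩ hk.continuousOn
  obtain ⟨τ, ⟨hτ, hkτ⟩, hleast⟩ := (isCompact_Icc.inter_right
    (isClosed_singleton.preimage hk : IsClosed (k ⁻¹' {k z}))).exists_isLeast ⟨z, hz, rfl⟩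
  have hkτ : k τ = k z := hkτ
  have hmax : ∀ y ∈ Icc a b, k y ≤ k τ := fun y hy => hkτ ▸ hzmax hy
  have hτpos : 0 < k τ := hpos.trans_le (hmax c hc)
  have haτ : a < τ := lt_of_le_of_ne hτ.1 fun e => by rw [← e, ha] at hτpos; exact hτpos.false
  have hτb : τ < b := lt_of_le_of_ne hτ.2 fun e => by rw [e, hb] at hτpos; exact hτpos.false
  obtain ⟨C, hC⟩ := hms.exists_bound_of_continuous hm
  have hC0 : 0 ≤ C := (norm_nonneg _).trans (hC p)
  set r := min (τ - a) (b - τ) with hr_def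
  have hr : 0 < r := lt_min (sub_pos.2 haτ) (sub_pos.2 hτb)
  set t := r / (C + 1) with ht_def
  have ht : 0 < t := by positivity
  have hsmall : ∀ x, |t * m x| ≤ r := fun x => by
    rw [abs_mul, abs_of_pos ht]
    calc t * |m x| ≤ t * (C + 1) := by
          gcongr
          exact (hC x).trans (by linarith)
      _ = r := by rw [ht_def]; field_simp
  have hmem : ∀ x, τ + t * m x ∈ Icc a b ∧ τ + -t * m x ∈ Icc a b := fun x => by
    have h1 := abs_le.1 (hsmall x)
    have h2 : r ≤ τ - a := min_le_left _ _
    have h3 : r ≤ b - τ := min_le_right _ _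
    refine ⟨⟨?_, ?_⟩, ⟨?_, ?_⟩⟩ <;> linarith
  have hkey : (k (τ + t * m p) - k τ) + (k (τ + -t * m p) - k τ) = 0 := by
    by_contra hne
    have hcont : Continuous fun x =>
        -((k (τ + t * m x) - k τ) + (k (τ + -t * m x) - k τ)) := by fun_prop
    have hsupp : HasCompactSupport fun x =>
        -((k (τ + t * m x) - k τ) + (k (τ + -t * m x) - k τ)) :=
      ((hasCompactSupport_comp_sub hms k τ t).add
        (hasCompactSupport_comp_sub hms k τ (-t))).neg
    have := hcont.integral_pos_of_hasCompactSupport_nonneg_nonzero (μ := volume) hsupp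
      (fun x => by
        have h1 := hmax _ (hmem x).1
        have h2 := hmax _ (hmem x).2
        simp only [Pi.zero_apply]
        linarith) (x := p) (neg_ne_zero.2 hne)
    rw [integral_neg, h τ t, neg_zero] at this
    exact this.false
  have h1 := hmax _ (hmem p).1
  have h2 := hmax _ (hmem p).2
  have e1 : τ ≤ τ + t * m p := hleast ⟨(hmem p).1, by
    change k (τ + t * m p) = k z; linarith⟩
  have e2 : τ ≤ τ + -t * m p := hleast ⟨(hmem p).2, by
    change k (τ + -t * m p) = k z; linarith⟩
  have e3 : t * m p = 0 := by linarith
  exact (mul_ne_zero ht.ne' hp) e3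

/-- A continuous function all of whose increments average to zero along `m` is affine. -/
theorem exists_affine_of_integral_eq_zero (hm : Continuous m) (hms : HasCompactSupport m)
    {p : Plane} (hp : m p ≠ 0) (hg : Continuous g)
    (h : ∀ τ t, ∫ x, (g (τ + t * m x) - g τ) = 0) :
    ∃ α β : ℝ, ∀ t, g t = α + β * t := by
  have hint : ∀ τ t, Integrable fun x => g (τ + t * m x) - g τ := fun τ t =>
    Continuous.integrable_of_hasCompactSupport (by fun_prop)
      (hasCompactSupport_comp_sub hms g τ t)
  -- On `[-R, R]`, compare `g` with its linear interpolant `l`, from both sides.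
  have key : ∀ R : ℝ, 0 < R → ∃ α β : ℝ, ∀ t ∈ Icc (-R) R, g t = α + β * t := by
    intro R hR
    set β := (g R - g (-R)) / (2 * R) with hβ
    set α := (g R + g (-R)) / 2 with hα
    have hβR : β * R = (g R - g (-R)) / 2 := by rw [hβ]; field_simp
    refine ⟨α, β, fun t ht => le_antisymm ?_ ?_⟩
    · have := nonpos_of_integral_symm_eq_zero hm hms hp
        (k := fun s => g s - (α + β * s)) (by fun_prop) (fun τ t => ?_)
        (a := -R) (b := R) (by linarith) (by linarith) ht
      · linarith
      · rw [← add_zero (0 : ℝ)]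
        nth_rewrite 1 [← h τ t]
        rw [← h τ (-t), ← integral_add (hint τ t) (hint τ (-t))]
        congr 1
        ext x
        ring
    · have := nonpos_of_integral_symm_eq_zero hm hms hp
        (k := fun s => -(g s - (α + β * s))) (by fun_prop) (fun τ t => ?_)
        (a := -R) (b := R) (by linarith) (by linarith) ht
      · linarith
      · rw [← neg_zero, ← add_zero (0 : ℝ)]
        nth_rewrite 1 [← h τ t]
        rw [← h τ (-t), ← integral_add (hint τ t) (hint τ (-t)), ← integral_neg]
        congr 1
        ext x
        ring
  refine ⟨g 0, g 1 - g 0, fun t => ?_⟩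
  obtain ⟨α, β, hαβ⟩ := key (|t| + 1) (by positivity)
  have h0 := hαβ 0 ⟨by linarith [abs_nonneg t], by linarith [abs_nonneg t]⟩
  have h1 := hαβ 1 ⟨by linarith [abs_nonneg t], by linarith [abs_nonneg t]⟩
  have h2 := hαβ t ⟨by linarith [neg_abs_le t], by linarith [le_abs_self t]⟩
  rw [h0, h1, h2]
  ring

end Averages

/-! ### Functions affine along shears -/

theorem eq_interpolation_of_affine {g : ℝ → ℝ} (h : ∃ α β : ℝ, ∀ t, g t = α + β * t) (t : ℝ) :
    g t = (1 - t) * g 0 + t * g 1 := by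
  obtain ⟨α, β, h⟩ := h
  rw [h, h 0, h 1]
  ring

/-- A function on `SL₂` which is affine along all upper shear lines is also affine along all lower
shear lines, as the two are conjugate by a quarter turn. -/
theorem affine_lowerShear {f : Mat2 → ℝ}
    (h : ∀ P ∈ SL2, ∀ Q ∈ SL2, ∃ α β : ℝ, ∀ t, f (P * upperShear t * Q) = α + β * t) :
    ∀ P ∈ SL2, ∀ Q ∈ SL2, ∃ α β : ℝ, ∀ t, f (P * lowerShear t * Q) = α + β * t := by
  intro P hP Q hQ
  have hJ : (!![0, -1; 1, 0] : Mat2) ∈ SL2 := by simp [SL2]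
  have hJ' : (!![0, 1; -1, 0] : Mat2) ∈ SL2 := by simp [SL2]
  obtain ⟨α, β, hαβ⟩ := h _ (mul_mem_SL2 _ hP _ hJ) _ (mul_mem_SL2 _ hJ' _ hQ)
  refine ⟨α, -β, fun t => ?_⟩
  have e : lowerShear t = !![0, -1; 1, 0] * upperShear (-t) * !![0, 1; -1, 0] := by
    simp [lowerShear, upperShear]
  have := hαβ (-t)
  rw [e]
  simp only [Matrix.mul_assoc] at this ⊢
  rw [this]
  ring

/-- A function on `SL₂` which is affine along all shear lines is affine. In the coordinates
`F = U x * L y * U z` it is affine in each variable; since `U x * U z = U (x + z)`, only one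
coefficient remains which does not belong to an affine function of the entries of `F`, and it
vanishes because `(F₀₀ - 1) (F₁₁ - 1) / F₁₀` is not affine along a lower shear line. -/
theorem exists_affine_of_affine_upperShear {f : Mat2 → ℝ}
    (h : ∀ P ∈ SL2, ∀ Q ∈ SL2, ∃ α β : ℝ, ∀ t, f (P * upperShear t * Q) = α + β * t) :
    ∃ (a : Mat2) (b : ℝ), ∀ F ∈ SL2, f F = (∑ i, ∑ j, a i j * F i j) + b := by
  have hL := affine_lowerShear h
  have hone : (1 : Mat2) ∈ SL2 := Matrix.det_one
  have hU0 : upperShear 0 = 1 := by simp [upperShear, Matrix.one_fin_two]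
  have hL0 : lowerShear 0 = 1 := by simp [lowerShear, Matrix.one_fin_two]
  set p : ℝ → ℝ → ℝ → ℝ := fun x y z => f (upperShear x * lowerShear y * upperShear z) with hp
  have hx : ∀ x y z, p x y z = (1 - x) * p 0 y z + x * p 1 y z := fun x y z => by
    refine eq_interpolation_of_affine (g := fun x => p x y z) ?_ x
    simpa [hp, Matrix.mul_assoc] using h 1 hone _
      (mul_mem_SL2 _ (lowerShear_mem_SL2 y) _ (upperShear_mem_SL2 z))
  have hy : ∀ x y z, p x y z = (1 - y) * p x 0 z + y * p x 1 z := fun x y z =>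
    eq_interpolation_of_affine (g := fun y => p x y z)
      (hL _ (upperShear_mem_SL2 x) _ (upperShear_mem_SL2 z)) y
  have hz : ∀ x y z, p x y z = (1 - z) * p x y 0 + z * p x y 1 := fun x y z => by
    refine eq_interpolation_of_affine (g := fun z => p x y z) ?_ z
    simpa [hp] using h _ (mul_mem_SL2 _ (upperShear_mem_SL2 x) _ (lowerShear_mem_SL2 y)) 1 hone
  have hxz : ∀ x z, p x 0 z = p (x + z) 0 0 := fun x z => by
    simp only [hp, hL0, hU0, Matrix.mul_one, upperShear_mul]
  have h101 : p 1 0 1 = 2 * p 1 0 0 - p 0 0 0 := by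
    rw [hxz, hx (1 + 1)]
    ring
  have h001 : p 0 0 1 = p 1 0 0 := by rw [hxz, zero_add]
  obtain ⟨k₀, ka, kb, kc, kd, ke, hk⟩ : ∃ k₀ ka kb kc kd ke : ℝ, ∀ F ∈ SL2, F 1 0 ≠ 0 →
      f F = k₀ + ka * F 0 0 + kb * F 0 1 + kc * F 1 0 + kd * F 1 1 +
        ke * ((F 0 0 - 1) * (F 1 1 - 1) / F 1 0) := by
    -- Coefficients of `1`, `x`, `y`, `xy`, `yz`, `xyz` in the polynomial `p`; those of `z` and
    -- `x` agree and that of `xz` vanishes.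
    set c₀ := p 0 0 0
    set cx := p 1 0 0 - p 0 0 0
    set cy := p 0 1 0 - p 0 0 0
    set cxy := p 1 1 0 - p 1 0 0 - p 0 1 0 + p 0 0 0
    set cyz := p 0 1 1 - p 0 1 0 - p 1 0 0 + p 0 0 0
    set cxyz := p 1 1 1 - p 1 1 0 - p 0 1 1 + p 0 1 0
    have hpoly : ∀ x y z, p x y z =
        c₀ + cx * (x + z) + cy * y + cxy * (x * y) + cyz * (y * z) + cxyz * (x * y * z) := by
      intro x y z
      rw [hx, hy 0 y z, hy 1 y z, hz 0 0 z, hz 0 1 z, hz 1 0 z, hz 1 1 z, h101, h001]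
      ring
    refine ⟨c₀ - cxy - cyz, cxy, cx, cy, cyz, cxyz - cx, fun F hF hc => ?_⟩
    have hd : F 0 0 * F 1 1 - F 0 1 * F 1 0 = 1 := by rw [← Matrix.det_fin_two]; exact hF
    have e : f F = p ((F 0 0 - 1) / F 1 0) (F 1 0) ((F 1 1 - 1) / F 1 0) := by
      rw [hp]
      simp only
      rw [← eq_shear_mul_shear_mul_shear hF hc]
    rw [e, hpoly]
    have hb : F 0 1 = (F 0 0 * F 1 1 - 1) / F 1 0 := by
      rw [eq_div_iff hc]
      linarith
    rw [hb]
    field_simp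
    ring
  have hke : ke = 0 := by
    have hG : (!![2, 3; 1, 2] : Mat2) ∈ SL2 := by
      simp only [SL2, mem_ofPred_eq, Matrix.det_fin_two_of]; norm_num
    have hline := eq_interpolation_of_affine (hL 1 hone _ hG) 2
    have hval : ∀ t : ℝ, 0 ≤ t → f (1 * lowerShear t * !![2, 3; 1, 2]) =
        k₀ + ka * 2 + kb * 3 + kc * (2 * t + 1) + kd * (3 * t + 2) +
          ke * ((3 * t + 1) / (2 * t + 1)) := fun t ht => by
      have e : 1 * lowerShear t * !![2, 3; 1, 2] = !![2, 3; 2 * t + 1, 3 * t + 2] := by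
        simp [lowerShear]
        constructor <;> ring
      rw [hk _ (mul_mem_SL2 _ (mul_mem_SL2 _ hone _ (lowerShear_mem_SL2 t)) _ hG)]
      · rw [e]
        simp
        left
        ring
      · rw [e]
        simp
        positivity
    rw [hval 2 (by norm_num), hval 0 le_rfl, hval 1 zero_le_one] at hline
    norm_num at hline
    linarith
  refine ⟨!![ka, kb; kc, kd], k₀, fun F hF => ?_⟩
  have hgen : ∀ G ∈ SL2, G 1 0 ≠ 0 →
      f G = k₀ + ka * G 0 0 + kb * G 0 1 + kc * G 1 0 + kd * G 1 1 := fun G hG hc => by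
    rw [hk G hG hc, hke]
    ring
  simp only [Fin.sum_univ_two, Matrix.of_apply, Matrix.cons_val', Matrix.cons_val_zero,
    Matrix.cons_val_one, Matrix.cons_val_fin_one]
  by_cases hc : F 1 0 = 0
  · -- Extrapolate from the points `F * L 1` and `F * L 2`, where the formula is known.
    have hd : F 0 0 * F 1 1 - F 0 1 * F 1 0 = 1 := by rw [← Matrix.det_fin_two]; exact hF
    have hd0 : F 1 1 ≠ 0 := fun h0 => by
      rw [h0, hc] at hd
      norm_num at hd
    have hline := eq_interpolation_of_affine (hL F hF 1 hone) 2
    have hval : ∀ t : ℝ, t ≠ 0 → f (F * lowerShear t * 1) =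
        k₀ + ka * (F 0 0 + F 0 1 * t) + kb * F 0 1 + kc * (F 1 1 * t) + kd * F 1 1 := by
      intro t ht
      rw [hgen _ (mul_mem_SL2 _ (mul_mem_SL2 _ hF _ (lowerShear_mem_SL2 t)) _ hone)]
      · simp [lowerShear, Matrix.mul_apply, Fin.sum_univ_two, hc]
      · simp [lowerShear, Matrix.mul_apply, Fin.sum_univ_two, hc, ht, hd0]
    rw [hval 2 two_ne_zero, hval 1 one_ne_zero, hL0, Matrix.mul_one, Matrix.mul_one] at hline
    rw [hc]
    linarith
  · rw [hgen F hF hc]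
    ring

/-! ### The two characterisations -/

/-- A continuous density on `SL₂` none of whose left translates distinguishes linear conjugates of
compactly supported area preserving diffeomorphisms from the identity is affine. -/
theorem exists_affine_of_integral_conj_eq_zero {W : Mat2 → ℝ} (hW : ContinuousOn W SL2)
    (h : ∀ F ∈ SL2, ∀ A B : Mat2, A * B = 1 → ∀ φ, IsCompactDiffeo SL2 univ φ →
      ∫ x, (W (F * (A * grad φ x * B)) - W F) = 0) :
    ∃ (a : Mat2) (b : ℝ), ∀ F ∈ SL2, W F = (∑ i, ∑ j, a i j * F i j) + b := by
  have hshear : ∀ P ∈ SL2, ∀ Q ∈ SL2, ∀ t,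
      ∫ x, (W (P * upperShear (t * shearProfile x) * Q) - W (P * 1 * Q)) = 0 := by
    intro P hP Q hQ
    have hQ' : Q * Q⁻¹ = 1 := Matrix.mul_nonsing_inv Q (by
      rw [show Q.det = 1 from hQ]; exact isUnit_one)
    refine integral_upperShear_eq_zero (V := fun X => W (P * X * Q)) ?_ fun A B hAB φ hφ => ?_
    · refine hW.comp (by fun_prop) fun X hX => ?_
      exact mul_mem_SL2 _ (mul_mem_SL2 _ hP _ hX) _ hQ
    · have hAB' : (Q⁻¹ * A) * (B * Q) = 1 := by
        rw [Matrix.mul_assoc, ← Matrix.mul_assoc A, hAB, Matrix.one_mul]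
        exact mul_eq_one_comm.1 hQ'
      have := h _ (mul_mem_SL2 _ hP _ hQ) _ _ hAB' φ hφ
      rw [← this]
      congr 1
      ext x
      congr 2
      · rw [show P * Q * (Q⁻¹ * A * grad φ x * (B * Q)) =
          P * (Q * Q⁻¹) * (A * grad φ x * B) * Q by simp only [Matrix.mul_assoc], hQ',
          Matrix.mul_one]
      · rw [Matrix.mul_one]
  refine exists_affine_of_affine_upperShear fun P hP Q hQ => ?_
  refine exists_affine_of_integral_eq_zero continuous_shearProfile hasCompactSupport_shearProfile
    (p := 0) (by rw [shearProfile_zero]; norm_num) ?_ fun τ t => ?_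
  · refine hW.comp_continuous ?_ fun t =>
      mul_mem_SL2 _ (mul_mem_SL2 _ hP _ (upperShear_mem_SL2 t)) _ hQ
    exact (continuous_const.mul continuous_upperShear).mul continuous_const
  · have := hshear _ (mul_mem_SL2 _ hP _ (upperShear_mem_SL2 τ)) Q hQ t
    simpa only [Matrix.mul_assoc, upperShear_mul, Matrix.one_mul, ← Matrix.mul_assoc (upperShear _)]
      using this

theorem theorem5p4 (Ω : Set Plane) (hΩ_open : IsOpen Ω) (hΩ_bounded : Bornology.IsBounded Ω)
    (hΩ_smooth : HasSmoothBoundary Ω) (hΩ_nonempty : Ω.Nonempty) :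
    (∀ W : Mat2 → ℝ, ContDiffOn ℝ 2 W SL2 →
      (∃ c : ℝ, ∀ φ : Plane → Plane, IsCompactDiffeo SL2 Ω φ →
        ∫ x in Ω, W (grad φ x) = c) →
      ∃ (a : Mat2) (b : ℝ), ∀ F ∈ SL2, W F = (∑ i, ∑ j, a i j * F i j) + b) ∧
    (∀ W : Mat2 → ℝ, ContDiffOn ℝ 2 W GL2 →
      (∀ u φ : Plane → Plane, IsCompactDiffeo GL2 Ω u → IsCompactDiffeo SL2 Ω φ →
        ∫ x in Ω, W (grad (u ∘ φ) x) = ∫ x in Ω, W (grad u x)) →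
      ∃ (a : ℝ → Mat2) (b : ℝ → ℝ), ∀ F ∈ GL2,
        W F = (∑ i, ∑ j, a F.det i j * F i j) + b F.det) := by
  obtain ⟨x₀, hx₀⟩ := hΩ_nonempty
  have hx₀ : Ω ∈ 𝓝 x₀ := hΩ_open.mem_nhds hx₀
  refine ⟨fun W hW ⟨c, hc⟩ => ?_, fun W hW hinv => ?_⟩
  · refine exists_affine_of_integral_conj_eq_zero hW.continuousOn fun F hF A B hAB φ hφ => ?_
    obtain ⟨u, hu, huF⟩ := localGradients_SL2 hx₀ hF
    exact integral_conj_eq_zero mul_mem_SL2 Subset.rfl hW.continuousOn hΩ_bounded hx₀ hu huF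
      (fun χ hχ => by rw [hc _ (hu.comp mul_mem_SL2 hχ), hc _ hu]) hAB hφ
  · -- On matrices of determinant `r ^ 2`, apply the unimodular case to `W (r •)`.
    have key : ∀ r : ℝ, 0 < r → ∃ (a : Mat2) (b : ℝ), ∀ F ∈ SL2,
        W (r • F) = (∑ i, ∑ j, a i j * F i j) + b := by
      intro r hr
      refine exists_affine_of_integral_conj_eq_zero (W := fun F => W (r • F)) ?_
        fun F hF A B hAB φ hφ => ?_
      · refine hW.continuousOn.comp (by fun_prop) fun F hF => ?_
        change 0 < (r • F).det
        rw [Matrix.det_smul, show F.det = 1 from hF]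
        positivity
      · obtain ⟨u, hu, huF⟩ := smul_mem_localGradients_GL2 hx₀ hr hF
        have := integral_conj_eq_zero mul_mem_GL2 SL2_subset_GL2 hW.continuousOn hΩ_bounded hx₀
          hu huF (fun χ hχ => hinv u χ hu hχ) hAB hφ
        simpa only [Matrix.smul_mul] using this
    choose! a b hab using key
    refine ⟨fun d => (Real.sqrt d)⁻¹ • a (Real.sqrt d), fun d => b (Real.sqrt d), fun F hF => ?_⟩
    have hdet : 0 < F.det := hF
    set r := Real.sqrt F.det with hr_def
    have hr : 0 < r := Real.sqrt_pos.2 hdet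
    have hmem : r⁻¹ • F ∈ SL2 := by
      change (r⁻¹ • F).det = 1
      rw [Matrix.det_smul, Fintype.card_fin, inv_pow, hr_def, Real.sq_sqrt hdet.le,
        inv_mul_cancel₀ hdet.ne']
    have := hab r hr _ hmem
    rw [smul_smul, mul_inv_cancel₀ hr.ne', one_smul] at this
    rw [this]
    simp only [Matrix.smul_apply, smul_eq_mul]
    congr 1
    refine Finset.sum_congr rfl fun i _ => Finset.sum_congr rfl fun j _ => ?_
    ring
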